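/- Fix the standard effective numbering $(\varphi_e)_{e\in\mathbb N}$ of the partial computable functions and put $W_e=\mathrm{dom}(\varphi_e)$. A language is a computably enumerable set $L\subseteq\mathbb N$. A text is a total function $T:\mathbb N\to\mathbb N\cup\{\#\}$; its content is $\mathrm{content}(T)=\mathrm{range}(T)\setminus\{\#\}$ (and likewise for finite sequences), $T$ is a text of $L$ if $\mathrm{content}(T)=L$, and $T[n]=(T(0),\dots,T(n-1))$. A learner is a partial computable function $h$. On a text $T$, a Gold-style learner produces the (possibly partial) sequence of hypotheses $p(n)=h(T[n])$, and a partially set-driven learner produces $p(n)=h(\mathrm{content}(T[n]),n)$, where $h$ receives finite sequences, respectively pairs of a finite set and a number, through a standard effective coding by natural numbers. For a total sequence $p:\mathbb N\to\mathbb N$ and a text $T$ define \begin{itemize} \item $\mathbf{Ex}(p,T)$: there is $n_0$ such that for all $n\ge n_0$, $p(n)=p(n_0)$ and $W_{p(n_0)}=\mathrm{content}(T)$; \item $\mathbf{Wb}(p,T)$: for all $n,m$, if there is $k$ with $n\le k\le m$ and $p(n)\ne p(k)$, then $(\mathrm{content}(T[m])\cap W_{p(m)})\setminus W_{p(n)}\neq\emptyset$;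 \item $\mathbf{CautTar}(p,T)$: for no $n$ is $\mathrm{content}(T)\subsetneq W_{p(n)}$. \end{itemize} A learner satisfies such a condition on a text if its sequence of hypotheses on that text is total and satisfies the condition. Let $[\tau(\mathbf{Wb})\mathbf{TxtPsdEx}]$ be the set of all classes $\mathcal L$ of languages for which there is a single partial computable learner $h$ such that, used as a partially set-driven learner, every $L\in\mathcal L$ is learned by $h$, meaning that $h$ satisfies $\mathbf{Wb}$ on every text whatsoever and satisfies $\mathbf{Ex}$ on every text of $L$. Let $[\mathbf{TxtGCautTarEx}]$ be the set of all classes $\mathcal L$ of languages for which there is a single partial computable learner $h$ that, used as a Gold-style learner, satisfies both $\mathbf{CautTar}$ and $\mathbf{Ex}$ on every text of every $L\in\mathcal L$ (with no requirement on other texts). Then $$[\tau(\mathbf{Wb})\mathbf{TxtPsdEx}]=[\mathbf{TxtGCautTarEx}].$$ -/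

import Mathlib

namespace LangLearn

/-- The `e`-th partial computable function, in the standard effective numbering by codes. -/
def phi (e : ℕ) : ℕ →. ℕ :=
  (Denumerable.ofNat Nat.Partrec.Code e).eval

/-- The `e`-th computably enumerable set, the domain of `phi e`. -/
def W (e : ℕ) : Set ℕ :=
  (phi e).Dom

/-- A language is a computably enumerable set of natural numbers. -/
def IsLanguage (L : Set ℕ) : Prop :=
  REPred fun x => x ∈ L

/-- A text is a total function into the natural numbers together with the pause symbol,
which is represented by `none`. -/
abbrev Text : Type := ℕ → Option ℕ

namespace Text

/-- The content of a text: all natural numbers occurring in it. -/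
def content (T : Text) : Set ℕ :=
  {x | ∃ n, T n = some x}

/-- The initial sequence `(T 0, …, T (n - 1))` of length `n`. -/
def initial (T : Text) (n : ℕ) : List (Option ℕ) :=
  (List.range n).map T

end Text

/-- The content of a finite sequence. -/
def seqContent (σ : List (Option ℕ)) : Finset ℕ :=
  σ.reduceOption.toFinset

/-- The canonical index of a finite set of natural numbers (its characteristic bit string). -/
def canonicalIndex (D : Finset ℕ) : ℕ :=
  ∑ x ∈ D, 2 ^ x

/-- A sequence interaction function: the information, coded as a natural number, which a
learner receives about a finite sequence. -/
abbrev Interaction : Type := List (Option ℕ) → ℕ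

/-- Gold-style (full) information: the sequence itself. -/
def gold : Interaction := fun σ => Encodable.encode σ

/-- Partially set-driven information: the content and the length of the sequence. -/
def psd : Interaction := fun σ => Nat.pair (canonicalIndex (seqContent σ)) σ.length

/-- The possibly partial sequence of hypotheses of the learner `h` on the text `T`. -/
def hypotheses (β : Interaction) (h : ℕ →. ℕ) (T : Text) : ℕ →. ℕ :=
  fun i => h (β (T.initial i))

/-- The partial computable functions. -/
def partialComputable : Set (ℕ →. ℕ) :=
  {h | Nat.Partrec h}

/-- A learning restriction, as a condition on the hypotheses produced on a text.
Hypotheses may be undefined, so that absence of a restriction can be expressed. -/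
abbrev Restriction : Type := (ℕ →. ℕ) → Text → Prop

/-- The restriction given by a predicate on total learning sequences: the sequence of
hypotheses has to be total and to satisfy the predicate. -/
def onTotal (δ : (ℕ → ℕ) → Text → Prop) : Restriction :=
  fun p T => ∃ q : ℕ → ℕ, (∀ n, p n = Part.some (q n)) ∧ δ q T

/-- The absence of a restriction. -/
def unrestricted : Restriction := fun _ _ => True

/-- Explanatory learning: convergence to a single correct hypothesis. -/
def Ex (p : ℕ → ℕ) (T : Text) : Prop :=
  ∃ n₀, ∀ n ≥ n₀, p n = p n₀ ∧ W (p n₀) = T.content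

/-- Witness-based sequences: every mind change is justified by a witness. -/
def Wb (p : ℕ → ℕ) (T : Text) : Prop :=
  ∀ n m, (∃ k, n ≤ k ∧ k ≤ m ∧ p n ≠ p k) →
    (((seqContent (T.initial m) : Set ℕ) ∩ W (p m)) \ W (p n)).Nonempty

/-- Target-cautious sequences: no hypothesis properly contains the target language. -/
def CautTar (p : ℕ → ℕ) (T : Text) : Prop :=
  ∀ n, ¬ T.content ⊂ W (p n)

/-- The class of languages learned by `h`: the restriction `α` holds on arbitrary texts and
`δ` holds on all texts of the language. -/
def learnedBy (α : Restriction) (β : Interaction) (δ : Restriction) (h : ℕ →. ℕ) :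
    Set (Set ℕ) :=
  {L | IsLanguage L ∧ (∀ T : Text, α (hypotheses β h T) T) ∧
    ∀ T : Text, T.content = L → δ (hypotheses β h T) T}

/-- The learning power of a criterion: all classes of languages which can be learned by a
single admissible learner. -/
def learningPower (α : Restriction) (C : Set (ℕ →. ℕ)) (β : Interaction) (δ : Restriction) :
    Set (Set (Set ℕ)) :=
  {𝓛 | ∃ h ∈ C, 𝓛 ⊆ learnedBy α β δ h}

end LangLearn

/-! From left to right, a Gold-style learner computes the partially set-driven information and
simulates. If a conjecture properly contained the target, the later change to the correct conjecture
would need a witness from the target outside it, which is impossible (`cautTar_of_wb_of_ex`).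

From right to left, let `c` be a target-cautious Gold-style learner. From a finite set and a number
`n`, the new learner simulates presenting the elements of that set in increasing order up to time
`n`, so order and repetition in the text are irrelevant. A conjecture made at time `t` on data `d`
picks a sequence `σ` over `d` that looks locking and enumerates the set that `c` conjectures on `σ`,
but only through stages that agree with `d` below `t` and do not themselves make `c` change its mind
on `σ`. It is abandoned only when the data both refute `σ` and leave the conjectured set.

Witnesses come from two sources: the second condition for abandonment, and the fact that a
conjecture has nothing but `d` below `t`, so that a late small datum lies outside it
(`not_subset_hypSet_of_ne`). Although conjectures are only c.e., abandonment is decidable: a stage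
that contains refuting data is never approved late (`inter_Iio_subset_hypSet_iff`).

The run stabilises because the first locking sequence is eventually chosen
(`GoldLearns.exists_sel_eq`). A conjecture that is never abandoned is correct: if `σ` is not refuted
on `L`, it is locking; if it is, the conjecture contains `L`, and target-caution excludes anything
more (`GoldLearns.hypSet_eq`). -/

namespace LangLearn

open Nat.Partrec (Code)
open Encodable (encode)

/-! ### Finite sets coded by bit strings -/

/-- The finite set whose characteristic bit string is `d`. -/
def bitSet (d : ℕ) : Set ℕ := {x | d.testBit x}

open Classical in
/-- The code of the set of the elements of `S` below `t`. -/
noncomputable def below (S : Set ℕ) (t : ℕ) : ℕ :=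
  canonicalIndex ((Finset.range t).filter (· ∈ S))

theorem testBit_canonicalIndex (D : Finset ℕ) (x : ℕ) :
    (canonicalIndex D).testBit x ↔ x ∈ D := by
  rw [← Nat.mem_bitIndices, ← List.mem_toFinset]
  simp [canonicalIndex]

theorem bitSet_canonicalIndex (D : Finset ℕ) : bitSet (canonicalIndex D) = D := by
  ext x
  exact testBit_canonicalIndex D x

theorem bitSet_injective : Function.Injective bitSet := fun _ _ h =>
  Nat.eq_of_testBit_eq fun i => Bool.eq_iff_iff.2 (Set.ext_iff.1 h i)

theorem bitSet_below (S : Set ℕ) (t : ℕ) : bitSet (below S t) = S ∩ Set.Iio t := by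
  ext x
  simp [below, bitSet_canonicalIndex, and_comm]

theorem below_eq_iff {S S' : Set ℕ} {t : ℕ} :
    below S t = below S' t ↔ S ∩ Set.Iio t = S' ∩ Set.Iio t := by
  rw [← bitSet_below, ← bitSet_below, bitSet_injective.eq_iff]

theorem inter_Iio_eq_of_le {S S' : Set ℕ} {s t : ℕ} (h : S ∩ Set.Iio t = S' ∩ Set.Iio t)
    (hst : s ≤ t) : S ∩ Set.Iio s = S' ∩ Set.Iio s := by
  have e : Set.Iio s = Set.Iio t ∩ Set.Iio s := by
    rw [Set.Iio_inter_Iio, min_eq_right hst]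
  rw [e, ← Set.inter_assoc, h, Set.inter_assoc]

/-! ### Refutation of sequences and the hypotheses -/

/-- The sequence `σ` only contains elements of `S` and pauses. -/
def Over (S : Set ℕ) (σ : List (Option ℕ)) : Prop := ∀ x, some x ∈ σ → x ∈ S

theorem Over.mono {S S' : Set ℕ} {σ : List (Option ℕ)} (h : Over S σ) (hS : S ⊆ S') :
    Over S' σ := fun x hx => hS (h x hx)

theorem Over.append {S : Set ℕ} {σ τ : List (Option ℕ)} (h : Over S σ) (h' : Over S τ) :
    Over S (σ ++ τ) := fun x hx => (List.mem_append.1 hx).elim (h x) (h' x)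

theorem over_nil (S : Set ℕ) : Over S [] := fun x hx => by simp at hx

/-- The `n`-th finite sequence. -/
def seqOf (n : ℕ) : List (Option ℕ) := Denumerable.ofNat (List (Option ℕ)) n

theorem seqOf_encode (σ : List (Option ℕ)) : seqOf (encode σ) = σ := Denumerable.ofNat_encode σ

/-- The hypothesis of the learner with code `c` on `σ`, if it is found within `t` steps. -/
def guess (c : Code) (t : ℕ) (σ : List (Option ℕ)) : Option ℕ := c.evaln t (encode σ)

theorem guess_mono {c : Code} {s t : ℕ} {σ : List (Option ℕ)} {a : ℕ} (hst : s ≤ t)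
    (h : guess c s σ = some a) : guess c t σ = some a :=
  Code.evaln_mono hst h

/-- Within `t` steps, the learner is seen to change its mind on an extension of `σ` by elements
of `S`. -/
def Refuted (c : Code) (σ : List (Option ℕ)) (S : Set ℕ) (t : ℕ) : Prop :=
  ∃ n < t, Over S (seqOf n) ∧ guess c t σ ≠ none ∧ guess c t (σ ++ seqOf n) ≠ none ∧
    guess c t σ ≠ guess c t (σ ++ seqOf n)

theorem Refuted.mono {c : Code} {σ : List (Option ℕ)} {S S' : Set ℕ} {t t' : ℕ}
    (h : Refuted c σ S t) (hS : S ⊆ S') (ht : t ≤ t') : Refuted c σ S' t' := by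
  obtain ⟨n, hn, ho, h1, h2, h3⟩ := h
  obtain ⟨a, ha⟩ := Option.ne_none_iff_exists'.1 h1
  obtain ⟨b, hb⟩ := Option.ne_none_iff_exists'.1 h2
  refine ⟨n, hn.trans_le ht, ho.mono hS, ?_⟩
  rw [guess_mono ht ha, guess_mono ht hb]
  rw [ha, hb] at h3
  simpa using h3

/-- The part of the set conjectured by the learner on `σ` which is found within `s` steps. -/
def stageSet (c : Code) (σ : List (Option ℕ)) (s : ℕ) : Set ℕ :=
  {x | ((guess c s σ).bind fun e => (Denumerable.ofNat Code e).evaln s x) ≠ none}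

theorem mem_stageSet {c : Code} {σ : List (Option ℕ)} {s x : ℕ} :
    x ∈ stageSet c σ s ↔ ∃ e, guess c s σ = some e ∧
      ∃ y, (Denumerable.ofNat Code e).evaln s x = some y := by
  simp only [stageSet, Set.mem_ofPred_eq, Option.ne_none_iff_exists', Option.bind_eq_some_iff]
  constructor
  · rintro ⟨y, e, h1, h2⟩
    exact ⟨e, h1, y, h2⟩
  · rintro ⟨e, h1, y, h2⟩
    exact ⟨y, e, h1, h2⟩

theorem stageSet_mono {c : Code} {σ : List (Option ℕ)} : Monotone (stageSet c σ) := by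
  intro s t hst x hx
  obtain ⟨e, h1, y, h2⟩ := mem_stageSet.1 hx
  exact mem_stageSet.2 ⟨e, guess_mono hst h1, y, Code.evaln_mono hst h2⟩

theorem lt_of_mem_stageSet {c : Code} {σ : List (Option ℕ)} {s x : ℕ}
    (h : x ∈ stageSet c σ s) : x < s := by
  obtain ⟨e, -, y, h2⟩ := mem_stageSet.1 h
  exact Code.evaln_bound h2

open Classical in
/-- The least index of a sequence over `S` which is not refuted within `t` steps. -/
noncomputable def baseIndex (c : Code) (S : Set ℕ) (t : ℕ) : ℕ :=
  Nat.findGreatest (fun m => ∀ n < m, ¬ (Over S (seqOf n) ∧ ¬ Refuted c (seqOf n) S t)) t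

open Classical in
/-- The first sequence over `S` which is not refuted within `t` steps. -/
noncomputable def base (c : Code) (S : Set ℕ) (t : ℕ) : List (Option ℕ) :=
  if Over S (seqOf (baseIndex c S t)) then seqOf (baseIndex c S t) else []

theorem over_base (c : Code) (S : Set ℕ) (t : ℕ) : Over S (base c S t) := by
  unfold base
  split_ifs with h
  exacts [h, over_nil S]

theorem base_eq {c : Code} {S : Set ℕ} {t n : ℕ} (hn : n < t) (ho : Over S (seqOf n))
    (hr : ¬ Refuted c (seqOf n) S t)
    (hl : ∀ m < n, Over S (seqOf m) → Refuted c (seqOf m) S t) : base c S t = seqOf n := by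
  classical
  have : baseIndex c S t = n := by
    rw [baseIndex, Nat.findGreatest_eq_iff]
    refine ⟨hn.le, fun _ m hm => ?_, fun m hm _ h => h n hm ⟨ho, hr⟩⟩
    rintro ⟨h1, h2⟩
    exact h2 (hl m hm h1)
  rw [base, this, if_pos ho]

/-- The stage `s` of the set conjectured on `σ` agrees with the set coded by `d` below `t`, and it
does not refute `σ`. -/
def Approved (c : Code) (σ : List (Option ℕ)) (d t s : ℕ) : Prop :=
  below (stageSet c σ s) t = d ∧ ¬ Refuted c σ (stageSet c σ s) s

/-- The set conjectured on the data `d` at time `t`: it contains the data, and grows as long as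
it is compatible with them and with the learner not changing its mind. -/
def hypSet (c : Code) (d t : ℕ) : Set ℕ :=
  bitSet d ∪ {x | ∃ s, Approved c (base c (bitSet d) t) d t s ∧
    x ∈ stageSet c (base c (bitSet d) t) s}

/-- Approval demands agreement with `d` below `t`. Hence any later datum below `t` is a witness
against the conjecture. -/
theorem mem_bitSet_of_mem_hypSet {c : Code} {d t x : ℕ} (h : x ∈ hypSet c d t) (hx : x < t) :
    x ∈ bitSet d := by
  rcases h with h | ⟨s, ⟨hs, -⟩, h⟩
  · exact h
  · rw [← hs, bitSet_below]
    exact ⟨h, hx⟩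

/-- The conjecture on the data `d` at time `t` is abandoned on the elements of `S` below `u`. -/
def Left (c : Code) (d t : ℕ) (S : Set ℕ) (u : ℕ) : Prop :=
  Refuted c (base c (bitSet d) t) (S ∩ Set.Iio u) u ∧ ¬ S ∩ Set.Iio u ⊆ hypSet c d t

theorem Left.mono {c : Code} {d t : ℕ} {S S' : Set ℕ} {u u' : ℕ} (h : Left c d t S u)
    (hS : S ∩ Set.Iio u ⊆ S') (hu : u ≤ u') : Left c d t S' u' := by
  have hS' : S ∩ Set.Iio u ⊆ S' ∩ Set.Iio u' := fun x hx => ⟨hS hx, lt_of_lt_of_le hx.2 hu⟩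
  exact ⟨h.1.mono hS' hu, fun h' => h.2 (hS'.trans h')⟩

/-- A finite set which refutes `σ` within `u` steps is contained in the conjecture only if it is
contained in a stage before `u`. -/
theorem inter_Iio_subset_hypSet_iff {c : Code} {d t : ℕ} {S : Set ℕ} {u : ℕ}
    (h : Refuted c (base c (bitSet d) t) (S ∩ Set.Iio u) u) :
    S ∩ Set.Iio u ⊆ hypSet c d t ↔ S ∩ Set.Iio u ⊆ bitSet d ∨
      ∃ s < u, Approved c (base c (bitSet d) t) d t s ∧
        S ∩ Set.Iio u ⊆ stageSet c (base c (bitSet d) t) s := by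
  set σ := base c (bitSet d) t with hσ
  constructor
  · intro hsub
    by_cases hd : S ∩ Set.Iio u ⊆ bitSet d
    · exact Or.inl hd
    right
    obtain ⟨y, hy, hyd⟩ := Set.not_subset.1 hd
    -- Stages increase, so finitely many elements fit into one approved stage. The element `y`
    -- outside the data supplies an approved stage for the empty set.
    have hdir : ∀ F : Finset ℕ, (F : Set ℕ) ⊆ S ∩ Set.Iio u →
        ∃ s, Approved c σ d t s ∧ (F : Set ℕ) ⊆ stageSet c σ s := by
      intro F
      induction F using Finset.induction_on with
      | empty =>
        intro _
        rcases hsub hy with h1 | ⟨s, h1, -⟩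
        · exact absurd h1 hyd
        · exact ⟨s, h1, by simp⟩
      | insert a F _ ih =>
        intro hF
        rw [Finset.coe_insert, Set.insert_subset_iff] at hF
        obtain ⟨s, hs, hFs⟩ := ih hF.2
        rcases hsub hF.1 with h1 | ⟨s', hs', ha⟩
        · refine ⟨s, hs, ?_⟩
          rw [Finset.coe_insert, Set.insert_subset_iff]
          refine ⟨?_, hFs⟩
          rw [← hs.1, bitSet_below] at h1
          exact h1.1
        · rcases le_total s s' with hle | hle
          · refine ⟨s', hs', ?_⟩
            rw [Finset.coe_insert, Set.insert_subset_iff]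
            exact ⟨ha, hFs.trans (stageSet_mono hle)⟩
          · refine ⟨s, hs, ?_⟩
            rw [Finset.coe_insert, Set.insert_subset_iff]
            exact ⟨stageSet_mono hle ha, hFs⟩
    have hfin : (S ∩ Set.Iio u).Finite := (Set.finite_Iio u).subset Set.inter_subset_right
    obtain ⟨s, hs, hsS⟩ := hdir hfin.toFinset (by simp)
    rw [hfin.coe_toFinset] at hsS
    refine ⟨s, ?_, hs, hsS⟩
    -- An approved stage from `u` on would contain the refuting data and so refute the base sequence
    -- itself.
    by_contra hlt
    exact hs.2 (h.mono hsS (not_lt.1 hlt))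
  · rintro (h1 | ⟨s, -, hs, h1⟩)
    · exact h1.trans Set.subset_union_left
    · exact fun x hx => Or.inr ⟨s, hs, h1 hx⟩

/-! ### The run of the learner on the canonical presentation of a set -/

open Classical in
/-- The time at which the current conjecture at time `t` was made, when the elements of `S` below
`0, 1, 2, …` are presented. -/
noncomputable def sel (c : Code) (S : Set ℕ) : ℕ → ℕ
  | 0 => 0
  | t + 1 => if Left c (below S (sel c S t)) (sel c S t) S (t + 1) then t + 1 else sel c S t

theorem sel_le (c : Code) (S : Set ℕ) (t : ℕ) : sel c S t ≤ t := by
  induction t with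
  | zero => exact le_rfl
  | succ t ih =>
    rw [sel]
    split_ifs
    exacts [le_rfl, ih.trans t.le_succ]

theorem sel_monotone (c : Code) (S : Set ℕ) : Monotone (sel c S) := by
  refine monotone_nat_of_le_succ fun t => ?_
  rw [sel]
  split_ifs
  exacts [(sel_le c S t).trans t.le_succ, le_rfl]

theorem sel_sel (c : Code) (S : Set ℕ) (t : ℕ) : sel c S (sel c S t) = sel c S t := by
  induction t with
  | zero => rfl
  | succ t ih =>
    by_cases h : Left c (below S (sel c S t)) (sel c S t) S (t + 1)
    · have : sel c S (t + 1) = t + 1 := by rw [sel, if_pos h]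
      rw [this, this]
    · have : sel c S (t + 1) = sel c S t := by rw [sel, if_neg h]
      rw [this, ih]

/-- The run up to time `t` inspects only elements below `t`; this allows runs on different sets to
be compared. -/
theorem sel_congr {c : Code} {S S' : Set ℕ} {t : ℕ} (h : S ∩ Set.Iio t = S' ∩ Set.Iio t) :
    sel c S t = sel c S' t := by
  induction t with
  | zero => rfl
  | succ t ih =>
    have e := ih (inter_Iio_eq_of_le h t.le_succ)
    have e' : below S (sel c S' t) = below S' (sel c S' t) :=
      below_eq_iff.2 (inter_Iio_eq_of_le h ((sel_le c S' t).trans t.le_succ))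
    have hL : Left c (below S (sel c S t)) (sel c S t) S (t + 1) ↔
        Left c (below S' (sel c S' t)) (sel c S' t) S' (t + 1) := by rw [e, e', Left, Left, h]
    by_cases hc : Left c (below S (sel c S t)) (sel c S t) S (t + 1)
    · rw [sel, sel, if_pos hc, if_pos (hL.1 hc)]
    · rw [sel, sel, if_neg hc, if_neg (mt hL.2 hc), e]

/-- A fresh conjecture contains its own data, and an older one has just passed the test. -/
theorem not_left_sel (c : Code) (S : Set ℕ) (t : ℕ) :
    ¬ Left c (below S (sel c S t)) (sel c S t) S t := by
  have key : ∀ t, ¬ Left c (below S t) t S t := fun t h =>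
    h.2 (by rw [← bitSet_below]; exact Set.subset_union_left)
  cases t with
  | zero => exact key 0
  | succ t =>
    by_cases h : Left c (below S (sel c S t)) (sel c S t) S (t + 1)
    · have : sel c S (t + 1) = t + 1 := by rw [sel, if_pos h]
      rw [this]
      exact key _
    · have : sel c S (t + 1) = sel c S t := by rw [sel, if_neg h]
      rwa [this]

/-- Abandonment persists under more data and time, so it still holds when the current conjecture is
made, however many changes lie in between. -/
theorem sel_eq_or_left {c : Code} {S : Set ℕ} {v : ℕ} (hv : sel c S v = v) {t : ℕ} (ht : v ≤ t) :
    sel c S t = v ∨ Left c (below S v) v S (sel c S t) := by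
  induction t, ht using Nat.le_induction with
  | base => exact Or.inl hv
  | succ t ht ih =>
    by_cases h : Left c (below S (sel c S t)) (sel c S t) S (t + 1)
    · have e : sel c S (t + 1) = t + 1 := by rw [sel, if_pos h]
      right
      rw [e]
      rcases ih with ih | ih
      · rwa [ih] at h
      · exact ih.mono Set.inter_subset_left ((sel_le c S t).trans t.le_succ)
    · have : sel c S (t + 1) = sel c S t := by rw [sel, if_neg h]
      rwa [this]

/-- A change of the conjecture is witnessed by the data available when the new one was made. -/
theorem not_subset_hypSet_of_ne {c : Code} {S S' : Set ℕ} {t t' : ℕ} (hS : S ⊆ S') (ht : t ≤ t')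
    (hne : ¬ (sel c S t = sel c S' t' ∧
      S ∩ Set.Iio (sel c S t) = S' ∩ Set.Iio (sel c S t))) :
    ¬ S' ∩ Set.Iio (sel c S' t') ⊆ hypSet c (below S (sel c S t)) (sel c S t) := by
  -- If the data differ below the time of the old conjecture, the new small datum is the witness.
  have hnew : ∀ u v, u ≤ v → u ≤ sel c S t → S ∩ Set.Iio u ≠ S' ∩ Set.Iio u →
      ¬ S' ∩ Set.Iio v ⊆ hypSet c (below S (sel c S t)) (sel c S t) := by
    intro u v huv hu hd hsub
    refine hd (Set.Subset.antisymm (Set.inter_subset_inter_left _ hS) fun y hy => ⟨?_, hy.2⟩)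
    have := mem_bitSet_of_mem_hypSet (hsub ⟨hy.1, lt_of_lt_of_le hy.2 huv⟩)
      (lt_of_lt_of_le hy.2 hu)
    rw [bitSet_below] at this
    exact this.1
  rcases lt_or_ge (sel c S' t') (sel c S t) with hlt | hge
  · by_cases hd : S ∩ Set.Iio (sel c S' t') = S' ∩ Set.Iio (sel c S' t')
    · exfalso
      -- The run on `S` makes the same conjecture and has already abandoned it; by persistence it
      -- cannot be current for `S'` at `t'`.
      have hv : sel c S (sel c S' t') = sel c S' t' := by rw [sel_congr hd, sel_sel]
      rcases sel_eq_or_left hv (hlt.le.trans (sel_le c S t)) with h | h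
      · exact hlt.ne' h
      · rw [below_eq_iff.2 hd] at h
        exact not_left_sel c S' t'
          (h.mono (Set.inter_subset_left.trans hS) ((sel_le c S t).trans ht))
    · exact hnew _ _ le_rfl hlt.le hd
  · by_cases hd : S ∩ Set.Iio (sel c S t) = S' ∩ Set.Iio (sel c S t)
    · have hv : sel c S' (sel c S t) = sel c S t := by rw [← sel_congr hd, sel_sel]
      rcases sel_eq_or_left hv (hge.trans (sel_le c S' t')) with h | h
      · exact absurd ⟨h.symm, hd⟩ hne
      · rw [below_eq_iff.2 hd]
        exact h.2
    · exact hnew _ _ hge le_rfl hd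

/-- An abandoned conjecture is never made again. -/
theorem sel_eq_of_between {c : Code} {S S' S'' : Set ℕ} {t t' t'' : ℕ} (hS : S ⊆ S')
    (hS' : S' ⊆ S'') (ht : t ≤ t') (ht' : t' ≤ t'') (he : sel c S t = sel c S'' t'')
    (hd : S ∩ Set.Iio (sel c S t) = S'' ∩ Set.Iio (sel c S t)) :
    sel c S t = sel c S' t' ∧ S ∩ Set.Iio (sel c S t) = S' ∩ Set.Iio (sel c S t) := by
  have hd' : S ∩ Set.Iio (sel c S t) = S' ∩ Set.Iio (sel c S t) :=
    Set.Subset.antisymm (Set.inter_subset_inter_left _ hS)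
      (hd ▸ Set.inter_subset_inter_left _ hS')
  refine ⟨?_, hd'⟩
  have hv : sel c S' (sel c S t) = sel c S t := by rw [← sel_congr hd', sel_sel]
  rcases sel_eq_or_left hv ((sel_le c S t).trans ht) with h | h
  · exact h.symm
  · exfalso
    rw [← below_eq_iff.2 hd', below_eq_iff.2 hd, he] at h
    exact not_left_sel c S'' t''
      (h.mono (Set.inter_subset_left.trans hS') ((sel_le c S' t').trans ht'))

/-! ### Texts -/

theorem Text.length_initial (T : Text) (n : ℕ) : (T.initial n).length = n := by
  simp [Text.initial]

theorem Text.over_initial (T : Text) (n : ℕ) : Over T.content (T.initial n) := by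
  intro x hx
  obtain ⟨i, -, hi⟩ := List.mem_map.1 hx
  exact ⟨i, hi⟩

theorem mem_seqContent {σ : List (Option ℕ)} {x : ℕ} : x ∈ seqContent σ ↔ some x ∈ σ := by
  simp [seqContent, List.reduceOption_mem_iff]

theorem Text.mem_seqContent_initial {T : Text} {n x : ℕ} :
    x ∈ seqContent (T.initial n) ↔ ∃ i < n, T i = some x := by
  simp [mem_seqContent, Text.initial]

theorem Text.seqContent_initial_mono (T : Text) {m n : ℕ} (h : m ≤ n) :
    (seqContent (T.initial m) : Set ℕ) ⊆ seqContent (T.initial n) := by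
  intro x hx
  obtain ⟨i, hi, hx⟩ := Text.mem_seqContent_initial.1 hx
  exact Text.mem_seqContent_initial.2 ⟨i, hi.trans_le h, hx⟩

theorem Text.seqContent_initial_subset (T : Text) (n : ℕ) :
    (seqContent (T.initial n) : Set ℕ) ⊆ T.content := by
  intro x hx
  obtain ⟨i, -, hx⟩ := Text.mem_seqContent_initial.1 hx
  exact ⟨i, hx⟩

open Classical in
/-- The text presenting the elements of `L` in increasing order, each at its own position. -/
noncomputable def canonicalText (L : Set ℕ) : Text := fun n => if n ∈ L then some n else none

theorem content_canonicalText (L : Set ℕ) : (canonicalText L).content = L := by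
  ext x
  simp only [Text.content, canonicalText, Set.mem_ofPred_eq]
  constructor
  · rintro ⟨n, hn⟩
    split_ifs at hn with h
    exact Option.some.inj hn ▸ h
  · exact fun hx => ⟨x, by simp [hx]⟩

/-- The text which starts with `σ` and continues as `T`. -/
def Text.prepend (σ : List (Option ℕ)) (T : Text) : Text := fun n =>
  if n < σ.length then σ.getD n none else T (n - σ.length)

theorem Text.initial_prepend (σ : List (Option ℕ)) (T : Text) (k : ℕ) :
    (Text.prepend σ T).initial (σ.length + k) = σ ++ T.initial k := by
  apply List.ext_getElem?
  intro i
  rcases lt_or_ge i σ.length with h | h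
  · simp [Text.initial, Text.prepend, h, h.trans_le (Nat.le_add_right _ k)]
  · rw [List.getElem?_append_right h]
    by_cases hk : i - σ.length < k
    · simp [Text.initial, Text.prepend, hk, show i < σ.length + k by omega, not_lt.2 h]
    · simp [Text.initial, hk, show ¬ i < σ.length + k by omega]

theorem Text.content_prepend {σ : List (Option ℕ)} {T : Text} (h : Over T.content σ) :
    (Text.prepend σ T).content = T.content := by
  ext x
  constructor
  · rintro ⟨n, hn⟩
    unfold Text.prepend at hn
    split_ifs at hn with hlt
    · refine h x ?_
      rw [List.getD_eq_getElem _ _ hlt] at hn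
      exact hn ▸ List.getElem_mem hlt
    · exact ⟨_, hn⟩
  · rintro ⟨n, hn⟩
    exact ⟨σ.length + n, by simp [Text.prepend, hn]⟩

/-- The text with the initial sequences `s 0, s 1, …`, each of which extends the previous one. -/
def Text.ofChain (s : ℕ → List (Option ℕ)) : Text := fun n => (s (n + 1)).getD n none

theorem Text.initial_ofChain {s : ℕ → List (Option ℕ)} (hs : ∀ n, s n <+: s (n + 1))
    (hl : ∀ n, n ≤ (s n).length) {ρ : List (Option ℕ)} {k : ℕ} (h : ρ <+: s k) :
    (Text.ofChain s).initial ρ.length = ρ := by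
  have hmono : ∀ m n, m ≤ n → s m <+: s n := fun m n hmn => by
    induction n, hmn using Nat.le_induction with
    | base => exact List.prefix_rfl
    | succ n _ ih => exact ih.trans (hs n)
  apply List.ext_getElem (by simp [Text.initial])
  intro i h1 h2
  have h3 : i < (s (i + 1)).length := hl (i + 1)
  have e1 := (hmono _ _ (le_max_left (i + 1) k)).getElem h3
  have e2 := (h.trans (hmono _ _ (le_max_right (i + 1) k))).getElem h2
  simp only [Text.initial, List.getElem_map, List.getElem_range, Text.ofChain]
  rw [List.getD_eq_getElem _ _ h3, e1, e2]

/-! ### Target-cautious Gold-style learners -/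

/-- The learner with code `c` learns `L` target-cautiously from arbitrary texts. -/
def GoldLearns (c : Code) (L : Set ℕ) : Prop :=
  ∀ T : Text, T.content = L →
    onTotal (fun p T => CautTar p T ∧ Ex p T) (hypotheses gold c.eval T) T

/-- No extension of `σ` by elements of `L` makes the learner change its mind. -/
def Locking (c : Code) (L : Set ℕ) (σ : List (Option ℕ)) : Prop :=
  ∀ τ, Over L τ → c.eval (encode (σ ++ τ)) = c.eval (encode σ)

/-- Every sequence over `L` begins some text of `L`, so totality and target-caution hold at each
such sequence. If it is locking, its value is also the limit on that text. -/
theorem GoldLearns.exists_eval {c : Code} {L : Set ℕ} (h : GoldLearns c L)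
    {σ : List (Option ℕ)} (hσ : Over L σ) :
    ∃ e, c.eval (encode σ) = Part.some e ∧ ¬ L ⊂ W e ∧ (Locking c L σ → W e = L) := by
  have hc : (Text.prepend σ (canonicalText L)).content = L := by
    rw [Text.content_prepend, content_canonicalText]
    rwa [content_canonicalText]
  obtain ⟨q, hq, hcaut, n₀, hn₀⟩ := h _ hc
  rw [CautTar, hc] at hcaut
  have e0 : c.eval (encode σ) = Part.some (q σ.length) := by
    have := hq (σ.length + 0)
    rw [hypotheses, gold, Text.initial_prepend] at this
    simpa [Text.initial] using this
  refine ⟨q σ.length, e0, hcaut _, fun hlock => ?_⟩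
  have e1 := hq (σ.length + n₀)
  rw [hypotheses, gold, Text.initial_prepend, hlock _ ?_, e0] at e1
  · rw [Part.some_inj.1 e1, (hn₀ (σ.length + n₀) (Nat.le_add_left _ _)).1,
      (hn₀ n₀ le_rfl).2, hc]
  · have := Text.over_initial (canonicalText L) n₀
    rwa [content_canonicalText] at this

/-- The classical locking argument: otherwise, alternating the elements of `L` with extensions that
force a mind change yields a text of `L` without convergence. -/
theorem GoldLearns.exists_locking {c : Code} {L : Set ℕ} (h : GoldLearns c L) :
    ∃ σ, Over L σ ∧ Locking c L σ := by
  by_contra! hno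
  have hstep : ∀ σ, ∃ τ, Over L σ → Over L τ ∧
      c.eval (encode (σ ++ τ)) ≠ c.eval (encode σ) := by
    intro σ
    by_cases hσ : Over L σ
    · have := hno σ hσ
      simp only [Locking, not_forall] at this
      obtain ⟨τ, h1, h2⟩ := this
      exact ⟨τ, fun _ => ⟨h1, h2⟩⟩
    · exact ⟨[], fun h' => absurd h' hσ⟩
  choose ext hext using hstep
  let mid : ℕ → List (Option ℕ) → List (Option ℕ) := fun n σ => σ ++ [canonicalText L n]
  obtain ⟨s, hs0, hs1⟩ : ∃ s : ℕ → List (Option ℕ), s 0 = [] ∧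
      ∀ n, s (n + 1) = mid n (s n) ++ ext (mid n (s n)) :=
    ⟨fun n => Nat.rec [] (fun n σ => mid n σ ++ ext (mid n σ)) n, rfl, fun _ => rfl⟩
  have hmid : ∀ n σ, Over L σ → Over L (mid n σ) := by
    intro n σ hσ
    refine hσ.append fun x hx => ?_
    have : x ∈ (canonicalText L).content := ⟨n, (List.mem_singleton.1 hx).symm⟩
    rwa [content_canonicalText] at this
  have hover : ∀ n, Over L (s n) := by
    intro n
    induction n with
    | zero => exact hs0 ▸ over_nil L
    | succ n ih => exact hs1 n ▸ (hmid n _ ih).append (hext _ (hmid n _ ih)).1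
  have hpre : ∀ n, mid n (s n) <+: s (n + 1) := fun n => hs1 n ▸ List.prefix_append _ _
  have hs : ∀ n, s n <+: s (n + 1) := fun n => (List.prefix_append _ _).trans (hpre n)
  have hlmid : ∀ n, (mid n (s n)).length = (s n).length + 1 := fun n => by simp [mid]
  have hl : ∀ n, n ≤ (s n).length := by
    intro n
    induction n with
    | zero => exact Nat.zero_le _
    | succ n ih =>
      have := (hpre n).length_le
      have := hlmid n
      omega
  have hcont : (Text.ofChain s).content = L := by
    apply Set.Subset.antisymm
    · rintro x ⟨n, hn⟩
      refine hover (n + 1) x ?_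
      have hlt : n < (s (n + 1)).length := hl (n + 1)
      unfold Text.ofChain at hn
      rw [List.getD_eq_getElem _ _ hlt] at hn
      exact hn ▸ List.getElem_mem hlt
    · intro x hx
      have h1 : some x ∈ mid x (s x) := by simp [mid, canonicalText, hx]
      rw [← Text.initial_ofChain hs hl (hpre x)] at h1
      exact Text.over_initial _ _ x h1
  obtain ⟨q, hq, -, n₀, hn₀⟩ := h _ hcont
  have hval : ∀ ρ k, ρ <+: s k → c.eval (encode ρ) = Part.some (q ρ.length) := by
    intro ρ k hρ
    have := hq ρ.length
    rwa [hypotheses, gold, Text.initial_ofChain hs hl hρ] at this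
  refine (hext (mid n₀ (s n₀)) (hmid _ _ (hover _))).2 ?_
  rw [← hs1, hval _ _ (hpre n₀), hval _ _ List.prefix_rfl]
  have h1 : n₀ ≤ (mid n₀ (s n₀)).length := by
    have := hlmid n₀
    have := hl n₀
    omega
  have h2 : n₀ ≤ (s (n₀ + 1)).length := h1.trans (hpre n₀).length_le
  rw [(hn₀ _ h1).1, (hn₀ _ h2).1]

theorem exists_guess {c : Code} {σ : List (Option ℕ)} {e : ℕ}
    (h : c.eval (encode σ) = Part.some e) : ∃ t, guess c t σ = some e :=
  Code.evaln_complete.1 (h ▸ Part.mem_some e)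

theorem mem_eval_of_guess {c : Code} {σ : List (Option ℕ)} {e t : ℕ}
    (h : guess c t σ = some e) : e ∈ c.eval (encode σ) :=
  Code.evaln_sound h

/-- The learner is defined on all sequences over `L`, so every failure of locking is found in finite
time. -/
theorem GoldLearns.locking_iff {c : Code} {L : Set ℕ} (h : GoldLearns c L)
    {σ : List (Option ℕ)} (hσ : Over L σ) : Locking c L σ ↔ ∀ t, ¬ Refuted c σ L t := by
  constructor
  · rintro hlock t ⟨n, -, ho, h1, h2, h3⟩
    obtain ⟨a, ha⟩ := Option.ne_none_iff_exists'.1 h1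
    obtain ⟨b, hb⟩ := Option.ne_none_iff_exists'.1 h2
    have hb' := mem_eval_of_guess hb
    rw [hlock _ ho] at hb'
    rw [ha, hb, Part.mem_unique (mem_eval_of_guess ha) hb'] at h3
    exact h3 rfl
  · intro hr τ hτ
    by_contra hne
    obtain ⟨a, ha, -⟩ := h.exists_eval hσ
    obtain ⟨b, hb, -⟩ := h.exists_eval (hσ.append hτ)
    rw [ha, hb, Part.some_inj] at hne
    obtain ⟨t, ht⟩ := exists_guess ha
    obtain ⟨u, hu⟩ := exists_guess hb
    have ht' := guess_mono (show t ≤ t + u + encode τ + 1 by omega) ht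
    have hu' := guess_mono (show u ≤ t + u + encode τ + 1 by omega) hu
    -- The bound lets both computations halt and exceeds the index of `τ`.
    refine hr (t + u + encode τ + 1) ⟨encode τ, by omega, ?_⟩
    rw [seqOf_encode, ht', hu']
    exact ⟨hτ, by simp, by simp, fun h' => hne (Option.some.inj h').symm⟩

theorem Over.exists_below {L : Set ℕ} {σ : List (Option ℕ)} (h : Over L σ) :
    ∃ u, ∀ t ≥ u, Over (L ∩ Set.Iio t) σ := by
  obtain ⟨u, hu⟩ := (seqContent σ).bddAbove
  refine ⟨u + 1, fun t ht x hx => ⟨h x hx, ?_⟩⟩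
  have := hu (mem_seqContent.2 hx)
  exact Set.mem_Iio.2 (by omega)

theorem Refuted.exists_below {c : Code} {σ : List (Option ℕ)} {L : Set ℕ} {t : ℕ}
    (h : Refuted c σ L t) : ∃ u, ∀ t' ≥ u, Refuted c σ (L ∩ Set.Iio t') t' := by
  obtain ⟨n, hn, ho, h'⟩ := h
  obtain ⟨u, hu⟩ := ho.exists_below
  refine ⟨max t u, fun t' ht' => ?_⟩
  have h1 : Refuted c σ (L ∩ Set.Iio t') t :=
    ⟨n, hn, hu t' ((le_max_right _ _).trans ht'), h'⟩
  exact h1.mono subset_rfl ((le_max_left _ _).trans ht')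

/-- The limit is the locking sequence of least index: each earlier sequence either is not over `L`
or is refuted by a finite part of `L`. -/
theorem GoldLearns.exists_base_eq {c : Code} {L : Set ℕ} (h : GoldLearns c L) :
    ∃ σ u, Locking c L σ ∧ Over L σ ∧ ∀ t ≥ u, base c (L ∩ Set.Iio t) t = σ := by
  classical
  have hex : ∃ n, Over L (seqOf n) ∧ Locking c L (seqOf n) := by
    obtain ⟨σ, h1, h2⟩ := h.exists_locking
    exact ⟨encode σ, by rwa [seqOf_encode], by rwa [seqOf_encode]⟩
  obtain ⟨hn1, hn2⟩ := Nat.find_spec hex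
  have hmin := fun m => @Nat.find_min _ _ hex m
  set n := Nat.find hex
  obtain ⟨u₁, hu₁⟩ := hn1.exists_below
  have hbad : ∀ m, ∃ u, m < n → Over L (seqOf m) →
      ∀ t ≥ u, Refuted c (seqOf m) (L ∩ Set.Iio t) t := by
    intro m
    by_cases hm : m < n ∧ Over L (seqOf m)
    · have := hmin m hm.1
      rw [not_and, h.locking_iff hm.2] at this
      have := this hm.2
      push Not at this
      obtain ⟨t, ht⟩ := this
      obtain ⟨u, hu⟩ := ht.exists_below
      exact ⟨u, fun _ _ => hu⟩
    · exact ⟨0, fun h1 h2 => absurd ⟨h1, h2⟩ hm⟩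
  choose u hu using hbad
  refine ⟨seqOf n, u₁ + (n + 1) + ∑ m ∈ Finset.range n, u m, hn2, hn1, fun t ht => ?_⟩
  refine base_eq (by omega) (hu₁ t (by omega)) ?_ ?_
  · exact fun hr => (h.locking_iff hn1).1 hn2 t (hr.mono Set.inter_subset_left le_rfl)
  · intro m hm ho
    refine hu m hm (ho.mono Set.inter_subset_left) t ?_
    have := Finset.single_le_sum (f := u) (fun _ _ => Nat.zero_le _) (Finset.mem_range.2 hm)
    omega

/-! ### Convergence -/

theorem GoldLearns.exists_sel_eq {c : Code} {L : Set ℕ} (h : GoldLearns c L) :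
    ∃ v, sel c L v = v ∧ ∀ t, ¬ Left c (below L v) v L t := by
  obtain ⟨σ, u, hlock, hσ, hu⟩ := h.exists_base_eq
  suffices ∃ v, sel c L v = v ∧ ∀ t ≥ v, sel c L t = v by
    obtain ⟨v, hv, hv'⟩ := this
    refine ⟨v, hv, fun t ht => ?_⟩
    have := not_left_sel c L (max t v)
    rw [hv' _ (le_max_right _ _)] at this
    exact this (ht.mono Set.inter_subset_left (le_max_left _ _))
  -- A conjecture made after `u` rests on a locking sequence and is never abandoned; if there is
  -- none, the run is constant from `u` on.
  by_cases hbig : ∃ v ≥ u, sel c L v = v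
  · obtain ⟨v, hvu, hv⟩ := hbig
    refine ⟨v, hv, fun t ht => (sel_eq_or_left hv ht).resolve_right fun hl => ?_⟩
    have hr := hl.1
    rw [bitSet_below, hu v hvu] at hr
    exact (h.locking_iff hσ).1 hlock _ (hr.mono Set.inter_subset_left le_rfl)
  · push Not at hbig
    refine ⟨sel c L u, sel_sel c L u, fun t ht => ?_⟩
    rcases le_total u t with hut | hut
    · induction t, hut using Nat.le_induction with
      | base => rfl
      | succ t hut ih =>
        rw [← ih ((sel_le c L u).trans hut)]
        by_cases hl : Left c (below L (sel c L t)) (sel c L t) L (t + 1)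
        · exact absurd (by rw [sel, if_pos hl]) (hbig (t + 1) (hut.trans t.le_succ))
        · rw [sel, if_neg hl]
    · exact le_antisymm (sel_monotone c L hut) (by simpa [sel_sel] using sel_monotone c L ht)

/-- The cases are whether `L` refutes `σ`. If not, `σ` is locking and all sufficiently late stages
are approved. If so, never abandoning gives `L ⊆ hypSet`, and target-caution gives equality. -/
theorem GoldLearns.hypSet_eq {c : Code} {L : Set ℕ} (h : GoldLearns c L) {v : ℕ}
    (hv : ∀ t, ¬ Left c (below L v) v L t) : hypSet c (below L v) v = L := by
  have hd : bitSet (below L v) ⊆ L := bitSet_below L v ▸ Set.inter_subset_left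
  set σ := base c (bitSet (below L v)) v with hσdef
  have hσ : Over L σ := (over_base c _ v).mono hd
  obtain ⟨e, he, hcaut, hcorrect⟩ := h.exists_eval hσ
  have hstage : ∀ s, stageSet c σ s ⊆ W e := by
    intro s x hx
    obtain ⟨e', h1, y, h2⟩ := mem_stageSet.1 hx
    have h3 := mem_eval_of_guess h1
    rw [he, Part.mem_some_iff] at h3
    subst h3
    exact Part.dom_iff_mem.2 ⟨y, Code.evaln_sound h2⟩
  by_cases hr : ∀ t, ¬ Refuted c σ L t
  · have hW := hcorrect ((h.locking_iff hσ).2 hr)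
    rw [hW] at hstage
    apply Set.Subset.antisymm
    · rintro x (hx | ⟨s, -, hx⟩)
      exacts [hd hx, hstage s hx]
    · intro x hx
      have hev : ∀ y ∈ L, ∃ s, y ∈ stageSet c σ s := by
        intro y hy
        rw [← hW] at hy
        obtain ⟨z, hz⟩ := Part.dom_iff_mem.1 hy
        obtain ⟨s, hs⟩ := Code.evaln_complete.1 hz
        obtain ⟨t, ht⟩ := exists_guess he
        exact ⟨max s t, mem_stageSet.2 ⟨e, guess_mono (le_max_right _ _) ht, z,
          Code.evaln_mono (le_max_left _ _) hs⟩⟩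
      have hev' : ∀ y, ∃ s, y ∈ L → y ∈ stageSet c σ s := fun y => by
        by_cases hy : y ∈ L
        · obtain ⟨s, hs⟩ := hev y hy
          exact ⟨s, fun _ => hs⟩
        · exact ⟨0, fun h' => absurd h' hy⟩
      choose f hf using hev'
      -- This stage is late enough for `x` and for all elements of `L` below `v`, so it agrees with
      -- the data there.
      have hfin : ∀ y ∈ L, y < v ∨ y = x →
          y ∈ stageSet c σ (f x + ∑ z ∈ Finset.range v, f z) := by
        intro y hy hy'
        refine stageSet_mono ?_ (hf y hy)
        rcases hy' with hlt | rfl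
        · have := Finset.single_le_sum (f := f) (fun _ _ => Nat.zero_le _)
            (Finset.mem_range.2 hlt)
          omega
        · omega
      refine Or.inr ⟨_, ⟨?_, ?_⟩, hfin x hx (Or.inr rfl)⟩
      · refine below_eq_iff.2 (Set.Subset.antisymm
          (Set.inter_subset_inter_left _ (hstage _)) fun y hy => ⟨?_, hy.2⟩)
        exact hfin y hy.1 (Or.inl hy.2)
      · exact fun hr' => hr _ (hr'.mono (hstage _) le_rfl)
  · push Not at hr
    obtain ⟨t, ht⟩ := hr
    obtain ⟨u, hu⟩ := ht.exists_below
    have hL : L ⊆ hypSet c (below L v) v := by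
      intro x hx
      by_contra hxn
      refine hv (max u (x + 1)) ⟨hu _ (le_max_left _ _), fun hsub => hxn (hsub ⟨hx, ?_⟩)⟩
      exact lt_of_lt_of_le x.lt_succ_self (le_max_right _ _)
    refine Set.Subset.antisymm ?_ hL
    -- An approved stage puts the data inside `W e`, so target-caution at `σ` applies. Without one,
    -- the conjecture is just the data.
    by_cases hap : ∃ s, Approved c σ (below L v) v s
    · obtain ⟨s, hs, -⟩ := hap
      have hsub : hypSet c (below L v) v ⊆ W e := by
        rintro x (hx | ⟨s', -, hx⟩)
        · rw [← hs, bitSet_below] at hx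
          exact hstage s hx.1
        · exact hstage s' hx
      by_contra hne
      exact hcaut ⟨hL.trans hsub, fun hWL => hne (hsub.trans hWL)⟩
    · push Not at hap
      rintro x (hx | ⟨s, hs, -⟩)
      · exact hd hx
      · exact absurd hs (hap s)

/-- On a text of `L`, the conjecture converges to the one which is final for `L`. -/
theorem sel_initial_eventually {c : Code} {T : Text} {v : ℕ} (hv : sel c T.content v = v)
    (hl : ∀ t, ¬ Left c (below T.content v) v T.content t) :
    ∃ n₀, ∀ n ≥ n₀, sel c (seqContent (T.initial n)) n = v ∧
      below (seqContent (T.initial n)) v = below T.content v := by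
  have hex : ∀ x, ∃ i, x ∈ T.content → T i = some x := fun x => by
    by_cases hx : x ∈ T.content
    · obtain ⟨i, hi⟩ := hx
      exact ⟨i, fun _ => hi⟩
    · exact ⟨0, fun h' => absurd h' hx⟩
  choose f hf using hex
  -- By then every element of the content below `v` has appeared, so the run agrees with that on the
  -- whole content up to `v`.
  refine ⟨v + 1 + ∑ z ∈ Finset.range v, f z, fun n hn => ?_⟩
  have hsub := T.seqContent_initial_subset n
  have hd : (seqContent (T.initial n) : Set ℕ) ∩ Set.Iio v = T.content ∩ Set.Iio v := by
    refine Set.Subset.antisymm (Set.inter_subset_inter_left _ hsub) fun y hy => ⟨?_, hy.2⟩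
    have := Finset.single_le_sum (f := f) (fun _ _ => Nat.zero_le _) (Finset.mem_range.2 hy.2)
    exact Text.mem_seqContent_initial.2 ⟨f y, by omega, hf y hy.1⟩
  refine ⟨?_, below_eq_iff.2 hd⟩
  have hv' : sel c (seqContent (T.initial n)) v = v := by rw [sel_congr hd, hv]
  refine (sel_eq_or_left hv' (by omega)).resolve_right fun h => ?_
  rw [below_eq_iff.2 hd] at h
  exact hl _ (h.mono (Set.inter_subset_left.trans hsub) le_rfl)

/-! ### Computability -/

theorem primrec_two_pow : Primrec fun n : ℕ => 2 ^ n :=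
  (Primrec₂.unpaired'.1 Nat.Primrec.pow).comp (.const 2) .id

theorem primrecRel_testBit : PrimrecRel fun d x : ℕ => x ∈ bitSet d := by
  have : PrimrecRel fun d x : ℕ => d / 2 ^ x % 2 = 1 :=
    Primrec.eq.comp₂ (Primrec.nat_mod.comp₂ (Primrec.nat_div.comp₂ .left
      (primrec_two_pow.comp₂ .right)) (.const 2)) (.const 1)
  exact this.of_eq fun d x => by simp [bitSet, Nat.testBit_eq_decide_div_mod_eq]

theorem PrimrecPred.mem_bitSet {α : Type*} [Primcodable α] {f g : α → ℕ} (hf : Primrec f)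
    (hg : Primrec g) : PrimrecPred fun a => g a ∈ bitSet (f a) :=
  primrecRel_testBit.comp hf hg

theorem PrimrecPred.ball_lt {α : Type*} [Primcodable α] {f : α → ℕ} {p : α → ℕ → Prop}
    (hf : Primrec f) (hp : PrimrecRel p) : PrimrecPred fun a => ∀ x < f a, p a x :=
  (hp.swap.forall_mem_list.comp (Primrec.list_range.comp hf) .id).of_eq fun a => by
    simp [Function.swap]

theorem PrimrecPred.bex_lt {α : Type*} [Primcodable α] {f : α → ℕ} {p : α → ℕ → Prop}
    (hf : Primrec f) (hp : PrimrecRel p) : PrimrecPred fun a => ∃ x < f a, p a x :=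
  (hp.swap.exists_mem_list.comp (Primrec.list_range.comp hf) .id).of_eq fun a => by
    simp [Function.swap]

open Classical in
theorem primrec_canonicalIndex_filter {α : Type*} [Primcodable α] {f : α → ℕ}
    {p : α → ℕ → Prop} (hf : Primrec f) (hp : PrimrecRel p) :
    Primrec fun a => canonicalIndex ((Finset.range (f a)).filter (p a)) := by
  have h := Primrec.nat_rec' (f := f) (g := fun _ => 0)
    (h := fun a (q : ℕ × ℕ) => if p a q.1 then q.2 + 2 ^ q.1 else q.2) hf (.const 0)
    (Primrec.ite (hp.comp .fst (Primrec.fst.comp .snd))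
      (Primrec.nat_add.comp (Primrec.snd.comp .snd)
        (primrec_two_pow.comp (Primrec.fst.comp .snd))) (Primrec.snd.comp .snd)).to₂
  refine h.of_eq fun a => ?_
  induction f a with
  | zero => rfl
  | succ n ih =>
    simp only [ih]
    rw [Finset.range_add_one, Finset.filter_insert]
    split_ifs
    · rw [canonicalIndex, canonicalIndex, Finset.sum_insert (by simp), add_comm]
    · rfl

theorem primrec_below {α : Type*} [Primcodable α] {f : α → ℕ} {S : α → Set ℕ} (hf : Primrec f)
    (hS : PrimrecRel fun a x => x ∈ S a) : Primrec fun a => below (S a) (f a) :=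
  primrec_canonicalIndex_filter hf hS

theorem primrecRel_bitSet_subset : PrimrecRel fun d d' : ℕ => bitSet d ⊆ bitSet d' := by
  have h : PrimrecPred fun q : ℕ × ℕ => ∀ x < q.1, x ∉ bitSet q.1 ∨ x ∈ bitSet q.2 :=
    PrimrecPred.ball_lt .fst <| PrimrecPred.or
      (PrimrecPred.mem_bitSet (Primrec.fst.comp .fst) .snd).not
      (PrimrecPred.mem_bitSet (Primrec.snd.comp .fst) .snd)
  refine PrimrecPred.of_eq h fun q => ?_
  constructor
  · intro h x hx
    refine (h x ?_).resolve_left (not_not.2 hx)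
    -- A set bit `x` forces `x < 2 ^ x ≤ q.1`, so the bounded search is exhaustive.
    exact Nat.lt_two_pow_self.trans_le (Nat.ge_two_pow_of_testBit hx)
  · intro h x _
    by_cases hx : x ∈ bitSet q.1
    exacts [Or.inr (h hx), Or.inl hx]

theorem primrecRel_over : PrimrecRel fun (σ : List (Option ℕ)) (d : ℕ) => Over (bitSet d) σ := by
  classical
  have h : PrimrecRel fun (o : Option ℕ) (d : ℕ) => ∀ x, o = some x → x ∈ bitSet d := by
    have h' : PrimrecPred fun q : Option ℕ × ℕ =>
        (Option.casesOn q.1 true fun x => decide (x ∈ bitSet q.2)) = true :=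
      Primrec.eq.comp (Primrec.option_casesOn .fst (.const true)
        (PrimrecPred.mem_bitSet (Primrec.snd.comp .fst) .snd).decide.to₂) (.const true)
    refine PrimrecPred.of_eq h' fun q => ?_
    obtain ⟨_ | x, d⟩ := q <;> simp
  refine h.forall_mem_list.of_eq fun σ d => ?_
  constructor
  · exact fun h x hx => h _ hx x rfl
  · rintro h o ho x rfl
    exact h x ho

theorem primrec_guess (c : Code) : Primrec₂ (guess c) :=
  Code.primrec_evaln.comp ((Primrec.fst.pair (.const c)).pair (Primrec.encode.comp .snd))

theorem primrec_seqOf : Primrec seqOf := Primrec.ofNat _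

section Predicates

variable {α : Type*} [Primcodable α] {σ : α → List (Option ℕ)} {d d' s t u : α → ℕ}

theorem primrecPred_over (hσ : Primrec σ) (hd : Primrec d) :
    PrimrecPred fun a => Over (bitSet (d a)) (σ a) :=
  primrecRel_over.comp hσ hd

theorem primrecPred_refuted (c : Code) (hσ : Primrec σ) (hd : Primrec d) (ht : Primrec t) :
    PrimrecPred fun a => Refuted c (σ a) (bitSet (d a)) (t a) := by
  have h1 : Primrec fun q : α × ℕ => guess c (t q.1) (σ q.1) :=
    (primrec_guess c).comp (ht.comp .fst) (hσ.comp .fst)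
  have h2 : Primrec fun q : α × ℕ => guess c (t q.1) (σ q.1 ++ seqOf q.2) :=
    (primrec_guess c).comp (ht.comp .fst)
      (Primrec.list_append.comp (hσ.comp .fst) (primrec_seqOf.comp .snd))
  have h3 : PrimrecPred fun q : α × ℕ => Over (bitSet (d q.1)) (seqOf q.2) :=
    primrecPred_over (primrec_seqOf.comp .snd) (hd.comp .fst)
  exact PrimrecPred.bex_lt ht <| h3.and <| (Primrec.eq.comp h1 (.const none)).not.and <|
    (Primrec.eq.comp h2 (.const none)).not.and (Primrec.eq.comp h1 h2).not

theorem primrecPred_mem_stageSet (c : Code) (hσ : Primrec σ) (hs : Primrec s) (ht : Primrec t) :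
    PrimrecPred fun a => t a ∈ stageSet c (σ a) (s a) := by
  have h : Primrec fun a => (guess c (s a) (σ a)).bind fun e =>
      (Denumerable.ofNat Code e).evaln (s a) (t a) :=
    Primrec.option_bind ((primrec_guess c).comp hs hσ)
      (Code.primrec_evaln.comp (((hs.comp .fst).pair ((Primrec.ofNat Code).comp .snd)).pair
        (ht.comp .fst))).to₂
  exact (Primrec.eq.comp h (.const none)).not

theorem primrec_below_stageSet (c : Code) (hσ : Primrec σ) (hs : Primrec s) (ht : Primrec t) :
    Primrec fun a => below (stageSet c (σ a) (s a)) (t a) :=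
  primrec_below ht (primrecPred_mem_stageSet c (hσ.comp .fst) (hs.comp .fst) .snd)

/-- Stage `s` lies below `s`, so it has a numerical code and the refutation test can be applied to
it. -/
theorem bitSet_below_stageSet (c : Code) (σ : List (Option ℕ)) (s : ℕ) :
    bitSet (below (stageSet c σ s) s) = stageSet c σ s := by
  rw [bitSet_below]
  exact Set.inter_eq_left.2 fun x hx => lt_of_mem_stageSet hx

theorem primrec_base (c : Code) (hd : Primrec d) (ht : Primrec t) :
    Primrec fun a => base c (bitSet (d a)) (t a) := by
  classical
  have hi : Primrec fun a => baseIndex c (bitSet (d a)) (t a) := by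
    refine Primrec.nat_findGreatest ht ?_
    refine PrimrecPred.ball_lt (α := α × ℕ) .snd ?_
    exact ((primrecPred_over (primrec_seqOf.comp .snd) (hd.comp (Primrec.fst.comp .fst))).and
      (primrecPred_refuted c (primrec_seqOf.comp .snd) (hd.comp (Primrec.fst.comp .fst))
        (ht.comp (Primrec.fst.comp .fst))).not).not
  exact Primrec.ite (primrecPred_over (primrec_seqOf.comp hi) hd) (primrec_seqOf.comp hi)
    (.const [])

theorem primrecPred_approved (c : Code) (hσ : Primrec σ) (hd : Primrec d) (ht : Primrec t)
    (hs : Primrec s) : PrimrecPred fun a => Approved c (σ a) (d a) (t a) (s a) := by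
  refine (Primrec.eq.comp (primrec_below_stageSet c hσ hs ht) hd).and ?_
  refine (primrecPred_refuted c hσ (primrec_below_stageSet c hσ hs hs) hs).not.of_eq fun a => ?_
  rw [bitSet_below_stageSet]

/-- Containment in the c.e. conjecture is tested only after refutation, where it reduces to a search
through the stages before `u`. -/
theorem primrecPred_left (c : Code) (hd : Primrec d) (ht : Primrec t) (hd' : Primrec d')
    (hu : Primrec u) : PrimrecPred fun a => Left c (d a) (t a) (bitSet (d' a)) (u a) := by
  have hb := primrec_base c hd ht
  have he : Primrec fun a => below (bitSet (d' a)) (u a) :=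
    primrec_below hu (PrimrecPred.mem_bitSet (hd'.comp .fst) .snd)
  have h1 := primrecPred_refuted c hb he hu
  have h2 := (primrecRel_bitSet_subset.comp he hd).not
  have h3 : PrimrecPred fun a => ∀ s < u a,
      ¬ (Approved c (base c (bitSet (d a)) (t a)) (d a) (t a) s ∧
      bitSet (below (bitSet (d' a)) (u a)) ⊆
        bitSet (below (stageSet c (base c (bitSet (d a)) (t a)) s) s)) :=
    PrimrecPred.ball_lt hu <| ((primrecPred_approved c (hb.comp .fst) (hd.comp .fst)
      (ht.comp .fst) .snd).and (primrecRel_bitSet_subset.comp (he.comp .fst)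
        (primrec_below_stageSet c (hb.comp .fst) .snd .snd))).not
  refine (h1.and (h2.and h3)).of_eq fun a => ?_
  simp only [bitSet_below_stageSet]
  rw [bitSet_below (bitSet (d' a))]
  refine and_congr_right fun hr => ?_
  rw [inter_Iio_subset_hypSet_iff hr]
  push Not
  rfl

theorem primrec_sel (c : Code) (hd : Primrec d) (ht : Primrec t) :
    Primrec fun a => sel c (bitSet (d a)) (t a) := by
  classical
  have hv : Primrec fun q : α × ℕ × ℕ => q.2.2 := Primrec.snd.comp .snd
  have hi : Primrec fun q : α × ℕ × ℕ => q.2.1 + 1 := Primrec.succ.comp (Primrec.fst.comp .snd)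
  have hb : Primrec fun q : α × ℕ × ℕ => below (bitSet (d q.1)) q.2.2 :=
    primrec_below (S := fun q : α × ℕ × ℕ => bitSet (d q.1)) hv
      (PrimrecPred.mem_bitSet (hd.comp (Primrec.fst.comp .fst)) .snd)
  have h := Primrec.nat_rec' (f := t) (g := fun _ => 0)
    (h := fun a (q : ℕ × ℕ) =>
      if Left c (below (bitSet (d a)) q.2) q.2 (bitSet (d a)) (q.1 + 1) then q.1 + 1 else q.2)
    ht (.const 0)
    (Primrec.ite (primrecPred_left c hb hv (hd.comp .fst) hi) hi hv).to₂
  refine h.of_eq fun a => ?_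
  induction t a with
  | zero => rfl
  | succ n ih => simp only [ih, sel]

end Predicates

/-- Membership is an unbounded search over a primitive recursive predicate, and currying makes the
index uniform in `d` and `t`. -/
theorem exists_index_hypSet (c : Code) :
    ∃ f : ℕ → ℕ → ℕ, Primrec₂ f ∧ ∀ d t, W (f d t) = hypSet c d t := by
  classical
  let P : ℕ → ℕ → ℕ → ℕ → Prop := fun d t x s => x ∈ bitSet d ∨
    (Approved c (base c (bitSet d) t) d t s ∧ x ∈ stageSet c (base c (bitSet d) t) s)
  have hp : PrimrecRel fun (n s : ℕ) => P n.unpair.1.unpair.1 n.unpair.1.unpair.2 n.unpair.2 s := by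
    have hn : Primrec fun q : ℕ × ℕ => q.1.unpair := Primrec.unpair.comp .fst
    have hx := Primrec.snd.comp hn
    have hn' : Primrec fun q : ℕ × ℕ => q.1.unpair.1.unpair :=
      Primrec.unpair.comp (Primrec.fst.comp hn)
    have hd := Primrec.fst.comp hn'
    have ht := Primrec.snd.comp hn'
    have hb := primrec_base c hd ht
    exact (PrimrecPred.mem_bitSet hd hx).or ((primrecPred_approved c hb hd ht .snd).and
      (primrecPred_mem_stageSet c hb .snd hx))
  have hpart : Nat.Partrec fun n => Nat.rfind fun s => Part.some (decide
      (P n.unpair.1.unpair.1 n.unpair.1.unpair.2 n.unpair.2 s)) :=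
    Partrec.nat_iff.1 (Partrec.rfind (Primrec.to_comp hp.decide).partrec)
  obtain ⟨cf, hcf⟩ := Code.exists_code.1 hpart
  refine ⟨fun d t => encode (Code.curry cf (Nat.pair d t)), ?_, fun d t => ?_⟩
  · exact Primrec.encode.comp (Code.primrec₂_curry.comp (.const cf)
      (Primrec₂.natPair.comp .fst .snd))
  · ext x
    have : x ∈ W (encode (Code.curry cf (Nat.pair d t))) ↔ ∃ s, P d t x s := by
      rw [W, phi, Denumerable.ofNat_encode, PFun.mem_dom, ← Part.dom_iff_mem, Code.eval_curry, hcf]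
      simp only [Nat.unpair_pair]
      exact Nat.rfind_dom.trans (by simp)
    rw [this]
    constructor
    · rintro ⟨s, h | h⟩
      exacts [Or.inl h, Or.inr ⟨s, h⟩]
    · rintro (h | ⟨s, h⟩)
      exacts [⟨0, Or.inl h⟩, ⟨s, Or.inr h⟩]

theorem primrec_canonicalIndex_seqContent :
    Primrec fun σ : List (Option ℕ) => canonicalIndex (seqContent σ) := by
  classical
  have h := Primrec.list_foldr (f := fun σ : List (Option ℕ) => σ) (g := fun _ => 0)
    (h := fun _ (q : Option ℕ × ℕ) => Option.casesOn q.1 q.2 fun x =>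
      if x ∈ bitSet q.2 then q.2 else 2 ^ x + q.2) .id (.const 0)
    (Primrec.option_casesOn (Primrec.fst.comp .snd) (Primrec.snd.comp .snd)
      (Primrec.ite (PrimrecPred.mem_bitSet (Primrec.snd.comp (Primrec.snd.comp .fst)) .snd)
        (Primrec.snd.comp (Primrec.snd.comp .fst))
        (Primrec.nat_add.comp (primrec_two_pow.comp .snd)
          (Primrec.snd.comp (Primrec.snd.comp .fst)))).to₂).to₂
  refine h.of_eq fun σ => ?_
  induction σ with
  | nil => rfl
  | cons o σ ih =>
    rw [List.foldr_cons, ih]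
    cases o with
    | none => simp [seqContent]
    | some x =>
      have e : seqContent (some x :: σ) = insert x (seqContent σ) := by simp [seqContent]
      simp only [e, bitSet_canonicalIndex, Finset.mem_coe]
      split_ifs with hx
      · rw [Finset.insert_eq_self.2 hx]
      · rw [canonicalIndex, canonicalIndex, Finset.sum_insert hx]

theorem primrec_psd : Primrec psd :=
  Primrec₂.natPair.comp primrec_canonicalIndex_seqContent Primrec.list_length

/-! ### The two inclusions -/

/-- A witness for leaving an overgeneralisation would be a target element outside a superset of the
target. -/
theorem cautTar_of_wb_of_ex {p : ℕ → ℕ} {T : Text} (hw : Wb p T) (he : Ex p T) : CautTar p T := by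
  intro n hn
  obtain ⟨n₀, h⟩ := he
  have h1 := h (max n n₀) (le_max_right _ _)
  rw [← h1.1] at h1
  by_cases hp : p n = p (max n n₀)
  · rw [hp, h1.2] at hn
    exact hn.ne rfl
  · obtain ⟨x, ⟨hx, -⟩, hx'⟩ := hw n (max n n₀) ⟨_, le_max_left _ _, le_rfl, hp⟩
    exact hx' (hn.1 (T.seqContent_initial_subset _ hx))

theorem wb_of_sel {c : Code} {f : ℕ → ℕ → ℕ} (hf : ∀ d t, W (f d t) = hypSet c d t) (T : Text) :
    Wb (fun n => f (below (seqContent (T.initial n)) (sel c (seqContent (T.initial n)) n))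
      (sel c (seqContent (T.initial n)) n)) T := by
  rintro n m ⟨k, hnk, hkm, hne⟩
  -- With the same time and data at `n` and `m`, the conjecture at `k` is the same too, as abandoned
  -- ones never return. Otherwise the data of the conjecture at `m`, which that conjecture contains,
  -- supply the witness.
  by_cases he : sel c (seqContent (T.initial n)) n = sel c (seqContent (T.initial m)) m ∧
      (seqContent (T.initial n) : Set ℕ) ∩ Set.Iio (sel c (seqContent (T.initial n)) n) =
        (seqContent (T.initial m) : Set ℕ) ∩ Set.Iio (sel c (seqContent (T.initial n)) n)
  · obtain ⟨h1, h2⟩ := sel_eq_of_between (T.seqContent_initial_mono hnk)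
      (T.seqContent_initial_mono hkm) hnk hkm he.1 he.2
    refine absurd ?_ hne
    beta_reduce
    rw [below_eq_iff.2 h2, h1]
  · obtain ⟨x, hx, hx'⟩ := Set.not_subset.1
      (not_subset_hypSet_of_ne (T.seqContent_initial_mono (hnk.trans hkm)) (hnk.trans hkm) he)
    refine ⟨x, ⟨hx.1, ?_⟩, ?_⟩
    · rw [hf]
      exact Or.inl (by rwa [bitSet_below])
    · rwa [hf]

theorem exists_psd_learner (c : Code) : ∃ h : ℕ →. ℕ, Nat.Partrec h ∧
    (∀ T : Text, onTotal Wb (hypotheses psd h T) T) ∧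
    ∀ L, GoldLearns c L → ∀ T : Text, T.content = L → onTotal Ex (hypotheses psd h T) T := by
  obtain ⟨f, hf, hW⟩ := exists_index_hypSet c
  let g : ℕ → ℕ := fun n => f (below (bitSet n.unpair.1) (sel c (bitSet n.unpair.1) n.unpair.2))
    (sel c (bitSet n.unpair.1) n.unpair.2)
  have hg : Primrec g := by
    have h1 : Primrec fun n : ℕ => n.unpair.1 := Primrec.fst.comp .unpair
    have hs := primrec_sel c h1 (Primrec.snd.comp .unpair)
    exact hf.comp (primrec_below hs (PrimrecPred.mem_bitSet (h1.comp .fst) .snd)) hs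
  have hp : ∀ (T : Text) n, hypotheses psd (fun n => Part.some (g n)) T n = Part.some
      (f (below (seqContent (T.initial n)) (sel c (seqContent (T.initial n)) n))
        (sel c (seqContent (T.initial n)) n)) := by
    intro T n
    simp only [hypotheses, psd, g, Nat.unpair_pair, bitSet_canonicalIndex, Text.length_initial]
  refine ⟨fun n => Part.some (g n), Partrec.nat_iff.1 hg.to_comp.partrec,
    fun T => ⟨_, hp T, wb_of_sel hW T⟩, fun L hL T hT => ⟨_, hp T, ?_⟩⟩
  subst hT
  obtain ⟨v, hv, hl⟩ := hL.exists_sel_eq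
  obtain ⟨n₀, h₀⟩ := sel_initial_eventually hv hl
  refine ⟨n₀, fun n hn => ?_⟩
  have h1 := h₀ n hn
  have h2 := h₀ n₀ le_rfl
  simp only [h1.1, h1.2, h2.1, h2.2, hW, hL.hypSet_eq hl, and_self]

end LangLearn

theorem mainTheorem9 :
    LangLearn.learningPower (LangLearn.onTotal LangLearn.Wb) LangLearn.partialComputable
        LangLearn.psd (LangLearn.onTotal LangLearn.Ex) =
      LangLearn.learningPower LangLearn.unrestricted LangLearn.partialComputable
        LangLearn.gold
        (LangLearn.onTotal fun p T => LangLearn.CautTar p T ∧ LangLearn.Ex p T) := by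
  open LangLearn in
  ext 𝓛
  constructor
  · rintro ⟨h, hh, hL⟩
    refine ⟨fun n => h (psd (seqOf n)), ?_, fun L hLm => ⟨(hL hLm).1, fun _ => trivial, ?_⟩⟩
    · exact Partrec.nat_iff.1 ((Partrec.nat_iff.2 hh).comp (primrec_psd.comp primrec_seqOf).to_comp)
    · intro T hT
      have e : hypotheses gold (fun n => h (psd (seqOf n))) T = hypotheses psd h T := by
        funext n
        simp only [hypotheses, gold, seqOf_encode]
      obtain ⟨q, hq, hw⟩ := (hL hLm).2.1 T
      obtain ⟨q', hq', he⟩ := (hL hLm).2.2 T hT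
      -- Both requirements concern the same total sequence of hypotheses.
      obtain rfl : q = q' := funext fun n => Part.some_inj.1 ((hq n).symm.trans (hq' n))
      rw [e]
      exact ⟨q, hq, cautTar_of_wb_of_ex hw he, he⟩
  · rintro ⟨h, hh, hL⟩
    obtain ⟨c, rfl⟩ := Nat.Partrec.Code.exists_code.1 hh
    obtain ⟨g, hg, hw, hex⟩ := exists_psd_learner c
    exact ⟨g, hg, fun L hLm => ⟨(hL hLm).1, hw, hex L (hL hLm).2.2⟩⟩
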